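/- Let $d\in\mathbb N$ and let $|\psi_{target}\rangle=\sum_{i=0}^{d-1}c_i|ii\rangle\in\mathbb C^d\otimes\mathbb C^d$ with $0<c_i<1$ for all $i$ and $\sum_i c_i^2=1$ (so $d\ge 2$). For settings $x\in\{0,1,2\}$ and outcomes $a\in\{0,\dots,d-1\}$ define positive $d\times d$ matrices $\bar\sigma_{a|x}$ as follows, where $B^{\pm}_{p,q}=\tfrac12\big(c_p|p\rangle\pm c_q|q\rangle\big)\big(c_p\langle p|\pm c_q\langle q|\big)$: - $\bar\sigma_{a|0}=c_a^2|a\rangle\langle a|$; - $\bar\sigma_{2m|1}=B^{+}_{2m,2m+1}$ and $\bar\sigma_{2m+1|1}=B^{-}_{2m,2m+1}$ for all $m\ge 0$ with $2m+1\le d-1$; for odd $d$, moreover $\bar\sigma_{d-1|1}=c_{d-1}^2|d-1\rangle\langle d-1|$; - $\bar\sigma_{2m+1|2}=B^{+}_{2m+1,2m+2}$ and $\bar\sigma_{2m+2|2}=B^{-}_{2m+1,2m+2}$ for all $m\ge 0$ with $2m+1\le d-1$, with the index $2m+2$ read modulo $d$; for odd $d$, moreover $\bar\sigma_{0|2}=c_0^2|0\rangle\langle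 0|$. Let $\bar M_{a|x}$ be the operators on $\mathbb C^d$ given by the same formulas with every $c_i$ replaced by $1$ (so $\bar M_{a|0}=|a\rangle\langle a|$, and $\bar M_{a|1},\bar M_{a|2}$ are the eigenprojections of the direct sums of $\sigma_x$ over the respective pairs of basis vectors, together with the single remaining basis projection if $d$ is odd). (i) $|\psi_{target}\rangle$ is a state, each $(\bar M_{a|x})_a$ is a projective measurement, and $\bar\sigma_{a|x}=\mathrm{tr}_A[(\bar M_{a|x}\otimes 1)\,|\psi_{target}\rangle\langle\psi_{target}|]$ for all $a,x$. (ii) Let $\mathcal H_A$ be any complex Hilbert space, $\rho^{AB}$ any density operator on $\mathcal H_A\otimes\mathbb C^d$, and, for each $x\in\{0,1,2\}$, let $(M_{a|x})_{a=0}^{d-1}$ be any measurement on $\mathcal H_A$, that is, $M_{a|x}\ge 0$ and $\sum_a M_{a|x}=1$. Suppose that Bob observes exactly the ideal assemblage: $\mathrm{tr}_A[(M_{a|x}\otimes 1)\rho^{AB}]=\bar\sigma_{a|x}$ for all $a,x$. Then there is an isometry $\Phi:\mathcal H_A\to\mathcal H_A\otimes\mathcal H_{A'}$, $\mathcal H_{A'}=\mathbb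 C^d$, such that, with $V=\Phi\otimes 1_B:\mathcal H_A\otimes\mathbb C^d\to\mathcal H_A\otimes(\mathcal H_{A'}\otimes\mathbb C^d)$: - if $\rho^{AB}=|\psi\rangle\langle\psi|$ is pure, then there is a unit vector $|junk\rangle\in\mathcal H_A$ with $$V|\psi\rangle=|junk\rangle\otimes|\psi_{target}\rangle,\qquad V(M_{a|x}\otimes 1)|\psi\rangle=|junk\rangle\otimes(\bar M_{a|x}\otimes 1)|\psi_{target}\rangle\quad\text{for all }a,x;$$ - in general, there is a density operator $\rho_{junk}$ on $\mathcal H_A$ with $$V\rho^{AB}V^\dagger=\rho_{junk}\otimes|\psi_{target}\rangle\langle\psi_{target}|,\qquad V(M_{a|x}\otimes 1)\rho^{AB}V^\dagger=\rho_{junk}\otimes(\bar M_{a|x}\otimes 1)|\psi_{target}\rangle\langle\psi_{target}|\quad\text{for all }a,x.$$ -/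

import Mathlib

open scoped TensorProduct InnerProductSpace

noncomputable section

namespace Steering

/-- The Hilbert space `ℂ^d`. -/
abbrev Qudit (d : ℕ) : Type := EuclideanSpace ℂ (Fin d)

/-- The computational basis vector `|i⟩`. -/
def ket {d : ℕ} (i : Fin d) : Qudit d := EuclideanSpace.single i 1

/-- The tensor product of a Hilbert space with a finite-dimensional one is complete, so that it is
the Hilbert-space tensor product. -/
instance completeSpace_tensor {H F : Type*}
    [NormedAddCommGroup H] [InnerProductSpace ℂ H] [CompleteSpace H]
    [NormedAddCommGroup F] [InnerProductSpace ℂ F] [FiniteDimensional ℂ F] :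
    CompleteSpace (H ⊗[ℂ] F) := by
  classical
  let b := stdOrthonormalBasis ℂ F
  let f : (H ⊗[ℂ] F) →L[ℂ] (Fin (Module.finrank ℂ F) → H) :=
    ContinuousLinearMap.pi fun i =>
      (TensorProduct.ridIsometry ℂ H).toContinuousLinearEquiv.toContinuousLinearMap ∘L
        (innerSL ℂ (b i)).lTensor H
  let g : (Fin (Module.finrank ℂ F) → H) →L[ℂ] (H ⊗[ℂ] F) :=
    ∑ i, ((TensorProduct.mkL ℂ H F).flip (b i)) ∘L ContinuousLinearMap.proj i
  have hgf : ∀ x, g (f x) = x := by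
    intro x
    induction x using TensorProduct.induction_on with
    | zero => simp
    | tmul x y =>
      simp only [f, g, _root_.sum_apply, ContinuousLinearMap.comp_apply,
        ContinuousLinearMap.proj_apply, ContinuousLinearMap.flip_apply,
        TensorProduct.mkL_apply_apply, ContinuousLinearMap.coe_pi']
      conv_rhs => rw [← b.sum_repr' y]
      simp [TensorProduct.tmul_sum, TensorProduct.smul_tmul]
    | add x y hx hy => rw [map_add, map_add, hx, hy]
  refine Metric.complete_of_cauchySeq_tendsto fun u hu => ?_
  obtain ⟨l, hl⟩ := cauchySeq_tendsto_of_complete (f.uniformContinuous.comp_cauchySeq hu)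
  refine ⟨g l, ?_⟩
  have := (g.continuous.tendsto l).comp hl
  refine this.congr fun n => hgf (u n)

section Operators

universe u

variable {E : Type u} [NormedAddCommGroup E] [InnerProductSpace ℂ E]

/-- `T` has trace `t`: the diagonal matrix elements of `T` sum to `t` in every Hilbert basis. -/
def HasTrace (T : E →L[ℂ] E) (t : ℂ) : Prop :=
  ∀ (ι : Type u) (b : HilbertBasis ι ℂ E), HasSum (fun k => ⟪b k, T (b k)⟫_ℂ) t

/-- A density operator: positive and of trace one. -/
def IsDensityOperator (ρ : E →L[ℂ] E) : Prop :=
  ρ.IsPositive ∧ HasTrace ρ 1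

/-- The operator `|ψ⟩⟨ψ|`. -/
def pureState (ψ : E) : E →L[ℂ] E := InnerProductSpace.rankOne ℂ ψ ψ

/-- A generalised measurement with outcomes `0, …, d-1`: positive operators that sum to one. -/
def IsMeasurement {d : ℕ} (M : Fin d → E →L[ℂ] E) : Prop :=
  (∀ a, (M a).IsPositive) ∧ ∑ a, M a = 1

/-- A projective measurement (outcomes may have the zero projection). -/
def IsProjectiveMeasurement {d : ℕ} (M : Fin d → E →L[ℂ] E) : Prop :=
  IsMeasurement M ∧ ∀ a b, M a * M b = if a = b then M a else 0

/-- `σ` is the partial trace `tr_A T` of an operator `T` on `E ⊗ ℂ^d` over the first factor,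
written as a matrix in the computational basis: `σ i j = ∑ k, ⟨k,i| T |k,j⟩` for every Hilbert
basis `|k⟩` of `E`. -/
def HasPartialTrace {d : ℕ} (T : E ⊗[ℂ] Qudit d →L[ℂ] E ⊗[ℂ] Qudit d)
    (σ : Matrix (Fin d) (Fin d) ℂ) : Prop :=
  ∀ (ι : Type u) (b : HilbertBasis ι ℂ E) (i j : Fin d),
    HasSum (fun k => ⟪b k ⊗ₜ[ℂ] ket i, T (b k ⊗ₜ[ℂ] ket j)⟫_ℂ) (σ i j)

/-- Bob observes the assemblage `σ x a = tr_A[(M x a ⊗ 1) ρ]` when Alice measures `M x` on her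
part of `ρ` for the settings `x = 0, 1, 2`. -/
def ProducesAssemblage {d : ℕ} (ρ : E ⊗[ℂ] Qudit d →L[ℂ] E ⊗[ℂ] Qudit d)
    (M : Fin 3 → Fin d → E →L[ℂ] E) (σ : Fin 3 → Fin d → Matrix (Fin d) (Fin d) ℂ) : Prop :=
  ∀ x a, HasPartialTrace ((M x a).rTensor (Qudit d) * ρ) (σ x a)

/-- The map `Φ ⊗ 1_B : A ⊗ B → A ⊗ (A' ⊗ B)` given by an isometry `Φ : A → A ⊗ A'`
on Alice's side. -/
def onAlice {d : ℕ} (Φ : E →ₗᵢ[ℂ] E ⊗[ℂ] Qudit d) :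
    E ⊗[ℂ] Qudit d →ₗᵢ[ℂ] E ⊗[ℂ] (Qudit d ⊗[ℂ] Qudit d) :=
  (TensorProduct.assocIsometry ℂ E (Qudit d) (Qudit d)).toLinearIsometry.comp
    (Φ.rTensor (Qudit d))

end Operators

/-- The target state `∑ i, c_i |ii⟩`. -/
def targetState {d : ℕ} (c : Fin d → ℝ) : Qudit d ⊗[ℂ] Qudit d :=
  ∑ i, (c i : ℂ) • (ket i ⊗ₜ[ℂ] ket i)

/-- The two-dimensional block supported on the indices `p, q`, with sign `s`:
`(w_p² |p⟩⟨p| + w_q² |q⟩⟨q| + s w_p w_q (|p⟩⟨q| + |q⟩⟨p|)) / 2`. -/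
def pairBlock {d : ℕ} (w : Fin d → ℝ) (p q : Fin d) (s : ℝ) : Matrix (Fin d) (Fin d) ℂ :=
  Matrix.single p p ((w p ^ 2 / 2 : ℝ) : ℂ) + Matrix.single q q ((w q ^ 2 / 2 : ℝ) : ℂ) +
    Matrix.single p q ((s * (w p * w q / 2) : ℝ) : ℂ) +
    Matrix.single q p ((s * (w p * w q / 2) : ℝ) : ℂ)

/-- The block `w_a² |a⟩⟨a|`. -/
def singleBlock {d : ℕ} (w : Fin d → ℝ) (a : Fin d) : Matrix (Fin d) (Fin d) ℂ :=
  Matrix.single a a ((w a ^ 2 : ℝ) : ℂ)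

/-- The block pattern common to the ideal assemblage and the ideal measurements. Here `a + 1` and
`a - 1` are taken modulo `d`.
* `x = 0`: outcome `a` has the block of the single index `a`.
* `x = 1`: outcomes `2m, 2m+1` have the blocks on `(2m, 2m+1)` with sign `+, -`; for odd `d` the
  outcome `d-1` has a single block.
* `x = 2`: outcomes `2m+1, 2m+2 (mod d)` have the blocks on `(2m+1, 2m+2 mod d)` with
  sign `+, -`; for odd `d` the outcome `0` has a single block. -/
def blockPattern {d : ℕ} [NeZero d] (w : Fin d → ℝ) (x : Fin 3) (a : Fin d) :
    Matrix (Fin d) (Fin d) ℂ :=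
  match x with
  | 0 => singleBlock w a
  | 1 =>
    if Even a.val then
      if a.val + 1 = d then singleBlock w a else pairBlock w a (a + 1) 1
    else pairBlock w (a - 1) a (-1)
  | 2 =>
    if Odd a.val then pairBlock w a (a + 1) 1
    else if a.val = 0 ∧ Odd d then singleBlock w a else pairBlock w (a - 1) a (-1)

/-- The ideal assemblage for the target state with Schmidt coefficients `c`. -/
def idealAssemblage {d : ℕ} [NeZero d] (c : Fin d → ℝ) :
    Fin 3 → Fin d → Matrix (Fin d) (Fin d) ℂ :=
  blockPattern c

/-- The ideal measurements on Alice's side. All weights are one, so that the blocks are the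
eigenprojections `|a⟩⟨a|` and `(|p⟩ ± |q⟩)(⟨p| ± ⟨q|) / 2` of the direct sums of `σ_x` on the
pairs `(p, q)`. -/
def idealMeasurement (d : ℕ) [NeZero d] (x : Fin 3) (a : Fin d) : Qudit d →L[ℂ] Qudit d :=
  Matrix.toEuclideanCLM (n := Fin d) (𝕜 := ℂ) (blockPattern (fun _ => 1) x a)

end Steering

end

/-! Write `ρ = R * R` with `R` self-adjoint and cut Alice's part into the operators `V i = (c i)⁻¹ •
(slice i ∘L R)`. Dividing by `c i * c j` turns the ideal assemblage into real symmetric projections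
`P x a`, so Bob's data say `tr (M x a V_i V_j†) = (P x a)_ij`.

The key step is rigidity (`comp_eq_sum_of_hasSum`): if `P x a` kills `z`, then the positive operator
`M x a` has zero trace against `C C†` with `C = ∑ z_i V_i`, hence `M x a` kills `C`. As `∑ a, M x a
= 1`, each `M x a` acts on the family `V` exactly by the matrix `P x a`, although it need not be a
projection on all of `H`.

Setting 0 then makes the ranges of the `V i` mutually orthogonal. In settings 1 and 2 the
reflections `2 M - 1` swap neighbouring `V i`, so products of them carry `V 0` to every `V i`
(`exists_comp_eq`). Cutting these products down to the closed range of `V 0` gives partial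
isometries, from which `exists_isometry_comp_eq_tmul_ket` builds `Φ` with `Φ (V i z) = V 0 z ⊗ |i⟩`.
Reassembling the slices, `Φ ⊗ 1` sends `R z` to `V 0 z ⊗ targetState c`; thus the junk state is `V 0
V 0†`, or the vector `V 0 (R ψ)` in the pure case. -/

noncomputable section

namespace Steering

/-! ### Hilbert–Schmidt operators and vanishing traces -/

section HilbertSchmidt

open ContinuousLinearMap

variable {H K : Type*} [NormedAddCommGroup H] [InnerProductSpace ℂ H]
  [NormedAddCommGroup K] [InnerProductSpace ℂ K]

variable {ι κ : Type*} (b : HilbertBasis ι ℂ H) (e : HilbertBasis κ ℂ K)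

theorem hasSum_norm_inner_sq (x : H) : HasSum (fun k => ‖⟪b k, x⟫_ℂ‖ ^ 2) (‖x‖ ^ 2) := by
  have h := Complex.hasSum_re (b.hasSum_inner_mul_inner x x)
  have h2 : (⟪x, x⟫_ℂ).re = ‖x‖ ^ 2 := by
    rw [inner_self_eq_norm_sq_to_K]; norm_cast
  rw [h2] at h
  refine h.congr_fun ?_
  intro k
  rw [← inner_conj_symm x (b k), ← Complex.normSq_eq_conj_mul_self, Complex.normSq_eq_norm_sq]
  norm_cast

/-- The squared matrix elements of an operator are summable if its squared column norms are. -/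
theorem summable_norm_inner_sq {A : H →L[ℂ] K} (hA : Summable fun k => ‖A (b k)‖ ^ 2) :
    Summable fun p : ι × κ => ‖⟪e p.2, A (b p.1)⟫_ℂ‖ ^ 2 := by
  refine (summable_prod_of_nonneg fun p => by positivity).2 ⟨fun k => ?_, ?_⟩
  · exact (hasSum_norm_inner_sq e (A (b k))).summable
  · exact hA.congr fun k => ((hasSum_norm_inner_sq e (A (b k))).tsum_eq).symm

variable [CompleteSpace H] [CompleteSpace K]

theorem exists_isSelfAdjoint_mul_self {T : H →L[ℂ] H} (hT : T.IsPositive) :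
    ∃ S : H →L[ℂ] H, adjoint S = S ∧ S * S = T := by
  have h0 : 0 ≤ T := (nonneg_iff_isPositive T).2 hT
  exact ⟨CFC.sqrt T, (CFC.sqrt_nonneg T).isSelfAdjoint, CFC.sqrt_mul_sqrt_self T h0⟩

theorem apply_eq_zero_of_inner_eq_zero {T : H →L[ℂ] H} (hT : T.IsPositive) {v : H}
    (hv : ⟪v, T v⟫_ℂ = 0) : T v = 0 := by
  obtain ⟨S, hS, rfl⟩ := exists_isSelfAdjoint_mul_self hT
  have h : ⟪S v, S v⟫_ℂ = 0 := by
    rw [← hv, ← adjoint_inner_right, hS]; rfl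
  simp [inner_self_eq_zero.1 h]

/-- The array of squared matrix elements is summable, and its column sums are these norms by
Parseval. -/
theorem summable_norm_adjoint_sq {A : H →L[ℂ] K} (hA : Summable fun k => ‖A (b k)‖ ^ 2) :
    Summable fun l => ‖adjoint A (e l)‖ ^ 2 := by
  have h := (summable_norm_inner_sq b e hA).prod_symm
  refine ((summable_prod_of_nonneg fun p => by positivity).1 h).2.congr fun l => ?_
  rw [← (hasSum_norm_inner_sq b (adjoint A (e l))).tsum_eq]
  refine tsum_congr fun k => ?_
  simp only [Prod.swap]
  rw [adjoint_inner_right, norm_inner_symm]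

/-- If `A` is a Hilbert–Schmidt operator and `tr (T A† A) = 0` for a positive operator `T`, then
`T A† = 0`. -/
theorem comp_adjoint_eq_zero_of_hasSum {T : H →L[ℂ] H} (hT : T.IsPositive) {A : H →L[ℂ] K}
    (hA : Summable fun k => ‖A (b k)‖ ^ 2)
    (h0 : HasSum (fun k => ⟪b k, T (adjoint A (A (b k)))⟫_ℂ) 0) : T ∘L adjoint A = 0 := by
  obtain ⟨w, e, -⟩ := exists_hilbertBasis ℂ K
  set C : K →L[ℂ] H := T ∘L adjoint A with hC
  have hCs : Summable fun l => ‖C (e l)‖ ^ 2 := by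
    refine Summable.of_nonneg_of_le (fun l => by positivity) (fun l => ?_)
      ((summable_norm_adjoint_sq b e hA).mul_left (‖T‖ ^ 2))
    rw [← mul_pow]
    exact pow_le_pow_left₀ (norm_nonneg _) (T.le_opNorm _) 2
  -- Cyclicity of the trace by Fubini: summing `f` over `l` first gives `tr (T A† A)`, and over `k`
  -- first gives `tr (A T A†)`, whose terms are nonnegative. Absolute summability holds because `f`
  -- is a product of two square-summable arrays.
  set f : ι × w → ℂ := fun p => ⟪b p.1, C (e p.2)⟫_ℂ * ⟪e p.2, A (b p.1)⟫_ℂ with hf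
  have hfs : Summable f := by
    refine Summable.of_norm_bounded
      ((summable_norm_inner_sq e b hCs).prod_symm.add (summable_norm_inner_sq b e hA)) fun p => ?_
    rw [hf, norm_mul]
    simp only [Prod.swap]
    nlinarith [sq_nonneg (‖⟪b p.1, C (e p.2)⟫_ℂ‖ - ‖⟪e p.2, A (b p.1)⟫_ℂ‖),
      sq_nonneg ‖⟪b p.1, C (e p.2)⟫_ℂ‖, sq_nonneg ‖⟪e p.2, A (b p.1)⟫_ℂ‖]
  have h1 : ∀ k, HasSum (fun l => f (k, l)) ⟪b k, T (adjoint A (A (b k)))⟫_ℂ := by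
    intro k
    have := e.hasSum_inner_mul_inner (adjoint C (b k)) (A (b k))
    simp only [adjoint_inner_left] at this
    exact this
  have h2 : ∀ l, HasSum (fun k => (f ∘ Prod.swap) (l, k))
      ⟪adjoint A (e l), T (adjoint A (e l))⟫_ℂ := by
    intro l
    have := b.hasSum_inner_mul_inner (adjoint A (e l)) (C (e l))
    refine this.congr_fun fun k => ?_
    simp [f, mul_comm, adjoint_inner_left]
  have hsum : HasSum f 0 := by
    have := hfs.hasSum.prod_fiberwise h1
    rw [← this.unique h0]; exact hfs.hasSum
  have hsum' : HasSum (f ∘ Prod.swap) 0 := (Equiv.prodComm w ι).hasSum_iff.2 hsum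
  have h3 := Complex.hasSum_re (hsum'.prod_fiberwise h2)
  have h4 : ∀ l, T (adjoint A (e l)) = 0 := by
    intro l
    refine apply_eq_zero_of_inner_eq_zero hT ?_
    have h5 := (hasSum_zero_iff_of_nonneg fun l => hT.re_inner_nonneg_right (adjoint A (e l))).1 h3
    have h6 := hT.inner_nonneg_right (adjoint A (e l))
    rw [Complex.nonneg_iff] at h6
    exact Complex.ext (congrFun h5 l) h6.2.symm
  refine ContinuousLinearMap.ext_on (Submodule.dense_iff_topologicalClosure_eq_top.2 e.dense_span) ?_
  rintro _ ⟨l, rfl⟩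
  exact (h4 l).trans (by simp)

end HilbertSchmidt

/-! ### Rigidity: the measurement acts by the ideal matrices -/

section Intertwining

open ContinuousLinearMap

variable {H K : Type*} [NormedAddCommGroup H] [InnerProductSpace ℂ H] [CompleteSpace H]
  [NormedAddCommGroup K] [InnerProductSpace ℂ K] [CompleteSpace K]

/-- If `tr (M a V_i V_j†) = (P a)_ij` for a measurement `M` and symmetric orthogonal projections
`P a` that sum to one, then `M a` acts on the family `V` by the matrix `P a`. -/
theorem comp_eq_sum_of_hasSum {d : ℕ} {ι : Type*} (b : HilbertBasis ι ℂ H)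
    {M : Fin d → H →L[ℂ] H} (hM : IsMeasurement M) {P : Fin d → Matrix (Fin d) (Fin d) ℂ}
    (hsymm : ∀ a, (P a).transpose = P a) (hsum : ∑ a, P a = 1)
    (hmul : ∀ a a', P a * P a' = if a = a' then P a else 0) {V : Fin d → K →L[ℂ] H}
    (hV : ∀ a i j, HasSum (fun k => ⟪b k, M a (V i (adjoint (V j) (b k)))⟫_ℂ) (P a i j))
    (a i : Fin d) : M a ∘L V i = ∑ j, P a j i • V j := by
  classical
  set C : (Fin d → ℂ) → K →L[ℂ] H := fun z => ∑ i, z i • V i with hC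
  have hadj : ∀ z, adjoint (C z) = ∑ j, star (z j) • adjoint (V j) := by
    intro z; simp only [hC, map_sum, LinearIsometryEquiv.map_smulₛₗ, RCLike.star_def]
  have key : ∀ z (T : H →L[ℂ] H) (Q : Matrix (Fin d) (Fin d) ℂ),
      (∀ i j, HasSum (fun k => ⟪b k, T (V i (adjoint (V j) (b k)))⟫_ℂ) (Q i j)) →
      HasSum (fun k => ⟪b k, T (C z (adjoint (C z) (b k)))⟫_ℂ)
        (∑ j, star (z j) * ∑ i, z i * Q i j) := by
    intro z T Q hQ
    have := hasSum_sum (s := Finset.univ) fun j _ =>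
      (hasSum_sum (s := Finset.univ) fun i _ => (hQ i j).mul_left (z i)).mul_left (star (z j))
    refine this.congr_fun fun k => ?_
    rw [hadj]
    simp [hC, map_sum, _root_.sum_apply, Finset.mul_sum]
  -- Summing the hypothesis over all outcomes gives `tr (C C†) < ∞`, so the adjoint of `C z` is
  -- Hilbert–Schmidt.
  have hsm : ∀ z, Summable fun k => ‖adjoint (C z) (b k)‖ ^ 2 := by
    intro z
    have h := key z 1 1 fun i j => by
      have := hasSum_sum (s := Finset.univ) fun a _ => hV a i j
      rw [← hsum, Matrix.sum_apply]
      refine this.congr_fun fun k => ?_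
      rw [← inner_sum, ← _root_.sum_apply, hM.2]
    refine (Complex.hasSum_re h).summable.congr fun k => ?_
    rw [one_apply_eq_self, ← adjoint_inner_left, inner_self_eq_norm_sq_to_K]
    norm_cast
  have hzero : ∀ a z, (P a).mulVec z = 0 → M a ∘L C z = 0 := by
    intro a z hz
    have h := key z (M a) (P a) (hV a)
    have h0 : ∑ j, star (z j) * ∑ i, z i * P a i j = 0 := by
      refine Finset.sum_eq_zero fun j _ => ?_
      have : ∑ i, z i * P a i j = (P a).mulVec z j := by
        conv_rhs => rw [← hsymm a]
        simp [Matrix.mulVec, dotProduct, mul_comm]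
      rw [this, hz]; simp
    rw [h0] at h
    -- The Hilbert–Schmidt operator here is `(C z)†`, so its adjoint is `C z` itself.
    have := comp_adjoint_eq_zero_of_hasSum b (hM.1 a) (hsm z) (by simpa using h)
    simpa using this
  have hadd : ∀ z z', C (z + z') = C z + C z' := by
    intro z z'; simp [hC, add_smul, Finset.sum_add_distrib]
  -- Every other `P a'` kills the range of `P a`, so every other `M a'` drops out of `∑ a', M a' =
  -- 1`.
  have h1 : M a ∘L C ((P a).mulVec (Pi.single i 1)) = C ((P a).mulVec (Pi.single i 1)) := by
    have : ∑ a', M a' ∘L C ((P a).mulVec (Pi.single i 1)) =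
        M a ∘L C ((P a).mulVec (Pi.single i 1)) := by
      refine Finset.sum_eq_single a (fun a' _ ha' => hzero _ _ ?_) (by simp)
      rw [Matrix.mulVec_mulVec, hmul, if_neg ha', Matrix.zero_mulVec]
    rw [← this]
    ext x
    simp only [_root_.sum_apply, comp_apply]
    rw [← _root_.sum_apply, hM.2, one_apply_eq_self]
  have h2 : M a ∘L C (Pi.single i 1 - (P a).mulVec (Pi.single i 1)) = 0 := by
    refine hzero _ _ ?_
    rw [Matrix.mulVec_sub, Matrix.mulVec_mulVec, hmul, if_pos rfl, sub_self]
  have h3 : V i = C (Pi.single i 1 - (P a).mulVec (Pi.single i 1)) +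
      C ((P a).mulVec (Pi.single i 1)) := by
    rw [← hadd, sub_add_cancel]
    simp [hC]
  rw [h3, comp_add, h2, zero_add, h1]
  simp [hC]

end Intertwining

/-! ### Building Alice's isometry from partial isometries -/

section Isometry

open ContinuousLinearMap

variable {H K : Type*} [NormedAddCommGroup H] [InnerProductSpace ℂ H]
  [NormedAddCommGroup K] [InnerProductSpace ℂ K]

/-- Operators that agree on the range of `V` agree on its closure. -/
theorem comp_starProjection_congr {F : Type*} [NormedAddCommGroup F] [InnerProductSpace ℂ F]
    {V : K →L[ℂ] H} {X Y : H →L[ℂ] F} (h : X ∘L V = Y ∘L V)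
    [(LinearMap.range V.toLinearMap).topologicalClosure.HasOrthogonalProjection] :
    X ∘L (LinearMap.range V.toLinearMap).topologicalClosure.starProjection =
      Y ∘L (LinearMap.range V.toLinearMap).topologicalClosure.starProjection := by
  ext v
  have hsub : closure (Set.range V) ⊆ {u | X u = Y u} :=
    closure_minimal (by rintro _ ⟨x, rfl⟩; exact congrArg (· x) h)
      (isClosed_eq X.continuous Y.continuous)
  exact hsub (Submodule.starProjection_apply_mem
    (LinearMap.range V.toLinearMap).topologicalClosure v)

variable [CompleteSpace H] [CompleteSpace K]

theorem inner_ket_ket {d : ℕ} (i j : Fin d) :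
    ⟪(ket i : Qudit d), ket j⟫_ℂ = if i = j then 1 else 0 := by
  simp [ket, EuclideanSpace.inner_single_left]

/-- Mutually orthogonal partial isometries `J i` with common initial projection `J 0` give an
isometry that maps `J i v` to `v ⊗ |i⟩`. -/
theorem exists_isometry_apply_eq_tmul_ket {d : ℕ} [NeZero d] (J : Fin d → H →L[ℂ] H)
    (hJ : ∀ i j, adjoint (J i) ∘L J j = if i = j then J 0 else 0) (hJ0 : ∀ i, J i ∘L J 0 = J i)
    (h0 : adjoint (J 0) = J 0) :
    ∃ Φ : H →ₗᵢ[ℂ] H ⊗[ℂ] Qudit d, ∀ i v, J 0 v = v → Φ (J i v) = v ⊗ₜ ket i := by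
  -- The projection onto the sum of the ranges of the `J i`.
  set Q : H →L[ℂ] H := ∑ i, J i ∘L adjoint (J i) with hQ
  have hJ' : ∀ i j v, adjoint (J i) (J j v) = if i = j then J 0 v else 0 := fun i j v => by
    have := congrArg (· v) (hJ i j)
    simp only [comp_apply] at this
    rw [this]; split_ifs <;> simp
  have hJ0' : ∀ i v, J i (J 0 v) = J i v := fun i v => congrArg (· v) (hJ0 i)
  have hQJ : ∀ j v, Q (J j v) = J j v := fun j v => by
    simp [hQ, _root_.sum_apply, hJ', apply_ite, hJ0']
  have hQQ : ∀ v, Q (Q v) = Q v := fun v => by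
    conv_lhs => rw [hQ]
    rw [hQ]
    simp only [_root_.sum_apply, comp_apply, map_sum]
    rw [Finset.sum_comm]
    refine Finset.sum_congr rfl fun j _ => ?_
    simp [hJ', apply_ite, hJ0']
  have hQadj : adjoint Q = Q := by
    simp [hQ, map_sum, adjoint_comp]
  have h0Q : ∀ v, J 0 (Q v) = J 0 v := fun v => by
    have : ∀ x w, ⟪x, J 0 w⟫_ℂ = ⟪J 0 x, w⟫_ℂ := fun x w => by
      conv_lhs => rw [← h0]
      rw [adjoint_inner_right]
    refine ext_inner_left ℂ fun x => ?_
    rw [this, this, ← adjoint_inner_left, hQadj, hQJ]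
  -- Off the range of `Q` the map is `v ↦ v ⊗ |0⟩`. This does not collide with the `i = 0` term: `J
  -- 0` kills `v - Q v`, so the two contributions to the `|0⟩` component are orthogonal.
  let L : H →ₗ[ℂ] H ⊗[ℂ] Qudit d :=
    ∑ i, ((TensorProduct.mk ℂ H (Qudit d)).flip (ket i)) ∘ₗ (adjoint (J i)).toLinearMap +
      ((TensorProduct.mk ℂ H (Qudit d)).flip (ket 0)) ∘ₗ (1 - Q).toLinearMap
  have hL : ∀ v, L v = ∑ i, adjoint (J i) v ⊗ₜ[ℂ] ket i + (v - Q v) ⊗ₜ[ℂ] ket 0 := fun v => by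
    simp [L, TensorProduct.sub_tmul]
  have horth : ∀ v, ⟪adjoint (J 0) v, v - Q v⟫_ℂ = 0 := fun v => by
    rw [adjoint_inner_left, map_sub, h0Q, sub_self, inner_zero_right]
  have horth' : ∀ v, ⟪v - Q v, adjoint (J 0) v⟫_ℂ = 0 := fun v => by
    rw [← inner_conj_symm, horth, map_zero]
  have hQv : ∀ v, ⟪Q v, Q v⟫_ℂ = ⟪v, Q v⟫_ℂ := fun v => by
    rw [← adjoint_inner_right, hQadj, hQQ]
  have hQv' : ∀ v, ⟪Q v, v⟫_ℂ = ⟪v, Q v⟫_ℂ := fun v => by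
    rw [← adjoint_inner_right, hQadj]
  have hnorm : ∀ v, ⟪L v, L v⟫_ℂ = ⟪v, v⟫_ℂ := fun v => by
    have h1 : ⟪∑ i, adjoint (J i) v ⊗ₜ[ℂ] (ket i : Qudit d),
        ∑ i, adjoint (J i) v ⊗ₜ[ℂ] (ket i : Qudit d)⟫_ℂ = ⟪v, Q v⟫_ℂ := by
      simp [sum_inner, inner_sum, inner_ket_ket, hQ, adjoint_inner_left]
    have h2 : ⟪∑ i, adjoint (J i) v ⊗ₜ[ℂ] (ket i : Qudit d),
        (v - Q v) ⊗ₜ[ℂ] (ket 0 : Qudit d)⟫_ℂ = 0 := by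
      simp only [sum_inner, TensorProduct.inner_tmul, inner_ket_ket]
      refine Finset.sum_eq_zero fun i _ => ?_
      split_ifs with h
      · subst h; rw [horth, zero_mul]
      · simp
    have h3 : ⟪(v - Q v) ⊗ₜ[ℂ] (ket 0 : Qudit d), ∑ i, adjoint (J i) v ⊗ₜ[ℂ] (ket i : Qudit d)⟫_ℂ
        = 0 := by
      simp only [inner_sum, TensorProduct.inner_tmul, inner_ket_ket]
      refine Finset.sum_eq_zero fun i _ => ?_
      split_ifs with h
      · subst h; rw [horth', zero_mul]
      · simp
    rw [hL, inner_add_left, inner_add_right, inner_add_right, h1, h2, h3, TensorProduct.inner_tmul,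
      inner_ket_ket, inner_sub_left, inner_sub_right, inner_sub_right, hQv, hQv']
    simp
  refine ⟨⟨L, fun v => ?_⟩, fun i v hv => ?_⟩
  · have := (inner_self_eq_norm_sq_to_K (𝕜 := ℂ) (L v)).symm.trans
      ((hnorm v).trans (inner_self_eq_norm_sq_to_K v))
    have h : ‖L v‖ ^ 2 = ‖v‖ ^ 2 := by exact_mod_cast this
    exact (sq_eq_sq₀ (norm_nonneg _) (norm_nonneg _)).1 h
  · change L (J i v) = _
    rw [hL, hQJ, sub_self, TensorProduct.zero_tmul, add_zero]
    refine (Finset.sum_eq_single i (fun j _ hj => ?_) (by simp)).trans ?_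
    · rw [hJ', if_neg hj, TensorProduct.zero_tmul]
    · rw [hJ', if_pos rfl, hv]

/-- Operators with mutually orthogonal ranges that are carried into each other by operators on `H`
are sent by an isometry to orthogonal copies of one of them. -/
theorem exists_isometry_comp_eq_tmul_ket {d : ℕ} [NeZero d] (V : Fin d → K →L[ℂ] H)
    (W : Fin d → H →L[ℂ] H) (hW : ∀ i, W i ∘L V 0 = V i)
    (hW' : ∀ i, adjoint (W i) ∘L V i = V 0)
    (horth : ∀ i j, i ≠ j → adjoint (V i) ∘L V j = 0) :
    ∃ Φ : H →ₗᵢ[ℂ] H ⊗[ℂ] Qudit d, ∀ i x, Φ (V i x) = V 0 x ⊗ₜ ket i := by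
  set U : Submodule ℂ H := (LinearMap.range (V 0).toLinearMap).topologicalClosure with hU
  have hUc : IsClosed (U : Set H) := Submodule.isClosed_topologicalClosure _
  have : CompleteSpace U := hUc.completeSpace_coe
  -- The `W i` are controlled only on the range of `V 0`; the operators `W i ∘L P` are the partial
  -- isometries needed.
  set P : H →L[ℂ] H := U.starProjection with hP
  have hPV : ∀ x, P (V 0 x) = V 0 x := fun x =>
    Submodule.starProjection_eq_self_iff.2
      (Submodule.le_topologicalClosure _ (LinearMap.mem_range_self _ x))
  have hPP : P ∘L P = P := U.isIdempotentElem_starProjection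
  have hPadj : adjoint P = P := (isSelfAdjoint_starProjection U)
  have hJ0 : W 0 ∘L P = P := by
    have := comp_starProjection_congr (X := W 0) (Y := 1) (by rw [hW 0]; rfl)
    exact this
  have hJ : ∀ i j, adjoint (W i ∘L P) ∘L (W j ∘L P) = if i = j then W 0 ∘L P else 0 := by
    intro i j
    rw [adjoint_comp, hPadj, hJ0]
    split_ifs with hij
    · subst hij
      have := comp_starProjection_congr (X := adjoint (W i) ∘L W i) (Y := 1) (V := V 0) (by rw [comp_assoc, hW, hW']; rfl)
      calc (P ∘L adjoint (W i)) ∘L (W i ∘L P) = P ∘L ((adjoint (W i) ∘L W i) ∘L P) := rfl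
        _ = P := by rw [this]; exact hPP
    -- Orthogonality is extended to the closure one side at a time: from `V_j† V_i = 0` to `V_j† W_i
    -- P = 0`, then, after taking adjoints, to `P W_i† W_j P = 0`.
    · have h1 : (adjoint (V j) ∘L W i) ∘L P = 0 := by
        have := comp_starProjection_congr (X := adjoint (V j) ∘L W i) (Y := 0) (V := V 0)
          (by rw [comp_assoc, hW, horth j i (Ne.symm hij), zero_comp])
        rw [this, zero_comp]
      have h2 : P ∘L adjoint (W i) ∘L V j = 0 := by
        have := congrArg adjoint h1
        rwa [adjoint_comp, adjoint_comp, adjoint_adjoint, map_zero, hPadj] at this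
      have := comp_starProjection_congr (X := P ∘L adjoint (W i) ∘L W j) (Y := 0) (V := V 0)
        (by rw [comp_assoc, comp_assoc, hW, h2, zero_comp])
      rw [zero_comp] at this
      exact this
  obtain ⟨Φ, hΦ⟩ := exists_isometry_apply_eq_tmul_ket (fun i => W i ∘L P) hJ
    (fun i => by rw [hJ0, comp_assoc, hPP]) (by rw [hJ0, hPadj])
  refine ⟨Φ, fun i x => ?_⟩
  have h1 : W i (V 0 x) = V i x := congrArg (· x) (hW i)
  have h2 := hΦ i (V 0 x) (by rw [hJ0, hPV])
  simpa only [comp_apply, hPV, h1] using h2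

end Isometry

/-! ### Combinatorics and algebra of the block pattern -/

section Blocks

variable {d : ℕ}

theorem singleBlock_apply (w : Fin d → ℝ) (a i j : Fin d) :
    singleBlock w a i j = w i * w j * singleBlock (fun _ => 1) a i j := by
  simp only [singleBlock, Matrix.single_apply]
  split_ifs with h
  · obtain ⟨rfl, rfl⟩ := h; push_cast; ring
  · simp

theorem pairBlock_apply (w : Fin d → ℝ) (p q : Fin d) (s : ℝ) (i j : Fin d) :
    pairBlock w p q s i j = w i * w j * pairBlock (fun _ => 1) p q s i j := by
  simp only [pairBlock, Matrix.add_apply, Matrix.single_apply, mul_add]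
  congr 1
  · congr 1
    · congr 1
      all_goals
        split_ifs with h
        · obtain ⟨rfl, rfl⟩ := h; push_cast; ring
        · simp
    · split_ifs with h
      · obtain ⟨rfl, rfl⟩ := h; push_cast; ring
      · simp
  · split_ifs with h
    · obtain ⟨rfl, rfl⟩ := h; push_cast; ring
    · simp

theorem pairBlock_comm (w : Fin d → ℝ) (p q : Fin d) (s : ℝ) :
    pairBlock w p q s = pairBlock w q p s := by
  simp only [pairBlock, mul_comm (w p) (w q)]
  abel

/-- This rescaling is the link between the ideal assemblage and the ideal projections. -/
theorem blockPattern_apply [NeZero d] (w : Fin d → ℝ) (x : Fin 3) (a i j : Fin d) :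
    blockPattern w x a i j = w i * w j * blockPattern (fun _ => 1) x a i j := by
  fin_cases x <;> simp only [blockPattern] <;> (try split_ifs) <;>
    first | exact singleBlock_apply .. | exact pairBlock_apply ..

/-- The index that shares a two-dimensional block with `a`, or `a` itself if there is none. -/
def partner [NeZero d] (x : Fin 3) (a : Fin d) : Fin d :=
  match x with
  | 0 => a
  | 1 => if Even a.val then if a.val + 1 = d then a else a + 1 else a - 1
  | 2 => if Odd a.val then a + 1 else if a.val = 0 ∧ Odd d then a else a - 1

/-- The sign of the outcome `a` in its two-dimensional block, or `0` if there is none. -/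
def blockSign [NeZero d] (x : Fin 3) (a : Fin d) : ℝ :=
  if partner x a = a then 0
  else match x with
    | 0 => 1
    | 1 => if Even a.val then 1 else -1
    | 2 => if Odd a.val then 1 else -1

theorem val_add_one_eq [NeZero d] (hd : 2 ≤ d) (a : Fin d) :
    (a + 1).val = if a.val + 1 = d then 0 else a.val + 1 := by
  have h1 : (1 : Fin d).val = 1 := by
    rw [Fin.val_one']; exact Nat.mod_eq_of_lt hd
  rw [Fin.val_add, h1]
  have := a.isLt
  split_ifs with h
  · rw [h, Nat.mod_self]
  · exact Nat.mod_eq_of_lt (by omega)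

theorem val_sub_one_eq [NeZero d] (hd : 2 ≤ d) (a : Fin d) :
    (a - 1).val = if a.val = 0 then d - 1 else a.val - 1 := by
  have h1 : (1 : Fin d).val = 1 := by
    rw [Fin.val_one']; exact Nat.mod_eq_of_lt hd
  rw [Fin.sub_def]
  simp only [h1]
  have := a.isLt
  split_ifs with h
  · rw [h]; exact Nat.mod_eq_of_lt (by omega)
  · rw [show d - 1 + a.val = (a.val - 1) + d by omega, Nat.add_mod_right]
    exact Nat.mod_eq_of_lt (by omega)

theorem val_partner_one [NeZero d] (hd : 2 ≤ d) (a : Fin d) : (partner 1 a).val =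
    if a.val % 2 = 0 then if a.val + 1 = d then a.val else a.val + 1 else a.val - 1 := by
  simp only [partner, Nat.even_iff]
  split_ifs with h1 h2
  · rfl
  · rw [val_add_one_eq hd, if_neg h2]
  · rw [val_sub_one_eq hd, if_neg (by omega)]

theorem val_partner_two [NeZero d] (hd : 2 ≤ d) (a : Fin d) : (partner 2 a).val =
    if a.val % 2 = 1 then if a.val + 1 = d then 0 else a.val + 1
    else if a.val = 0 then if d % 2 = 1 then 0 else d - 1 else a.val - 1 := by
  simp only [partner, Nat.odd_iff]
  split_ifs with h1 h2 h3 h4 h5 h6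
  all_goals first
    | (rw [val_add_one_eq hd]; split_ifs; omega)
    | (rw [val_sub_one_eq hd]; split_ifs; omega)
    | omega

/-- Each setting partitions the indices into pairs and fixed points; for setting 2 and even `d` one
pair wraps around as `{d - 1, 0}`. -/
theorem partner_partner [NeZero d] (hd : 2 ≤ d) (x : Fin 3) (a : Fin d) :
    partner x (partner x a) = a := by
  have ha := a.isLt
  fin_cases x
  · rfl
  · refine Fin.ext ?_
    change (partner 1 (partner 1 a)).val = a.val
    have h1 := val_partner_one hd a
    have h2 := val_partner_one hd (partner 1 a)
    split_ifs at h1 h2 <;> omega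
  · refine Fin.ext ?_
    change (partner 2 (partner 2 a)).val = a.val
    have h1 := val_partner_two hd a
    have h2 := val_partner_two hd (partner 2 a)
    split_ifs at h1 h2 <;> omega

theorem blockSign_partner [NeZero d] (hd : 2 ≤ d) (x : Fin 3) (a : Fin d) :
    blockSign x (partner x a) = -blockSign x a := by
  have ha := a.isLt
  unfold blockSign
  rw [partner_partner hd]
  by_cases h : partner x a = a
  · rw [if_pos h, if_pos h.symm, neg_zero]
  rw [if_neg h, if_neg (Ne.symm h)]
  fin_cases x
  · exact absurd rfl h
  · have h' : (partner 1 a).val ≠ a.val := fun h' => h (Fin.ext h')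
    have h2 := val_partner_one hd a
    change (if Even (partner 1 a).val then (1 : ℝ) else -1) = -(if Even a.val then (1 : ℝ) else -1)
    simp only [Nat.even_iff]
    split_ifs at h2 ⊢ <;> first | omega | simp
  · have h' : (partner 2 a).val ≠ a.val := fun h' => h (Fin.ext h')
    have h2 := val_partner_two hd a
    change (if Odd (partner 2 a).val then (1 : ℝ) else -1) = -(if Odd a.val then (1 : ℝ) else -1)
    simp only [Nat.odd_iff]
    split_ifs at h2 ⊢ <;> first | omega | simp

theorem blockSign_sq [NeZero d] (x : Fin 3) (a : Fin d) :
    blockSign x a ^ 2 = if partner x a = a then 0 else 1 := by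
  unfold blockSign
  by_cases h : partner x a = a
  · simp [h]
  · rw [if_neg h, if_neg h]
    fin_cases x <;> simp only <;> (try split_ifs) <;> norm_num

/-- Replaces the parity cases by one description, so that the projection algebra is done once for
all settings. -/
theorem blockPattern_eq [NeZero d] (hd : 2 ≤ d) (w : Fin d → ℝ) (x : Fin 3) (a : Fin d) :
    blockPattern w x a = if partner x a = a then singleBlock w a
      else pairBlock w a (partner x a) (blockSign x a) := by
  have hne1 : a + 1 ≠ a := fun h => by
    have := congrArg Fin.val h
    rw [val_add_one_eq hd] at this
    split_ifs at this <;> omega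
  have hne2 : a - 1 ≠ a := fun h => by
    have := congrArg Fin.val h
    rw [val_sub_one_eq hd] at this
    split_ifs at this <;> omega
  fin_cases x
  · simp [blockPattern, partner]
  · by_cases h1 : Even a.val
    · by_cases h2 : a.val + 1 = d
      · simp [blockPattern, partner, h1, h2]
      · simp [blockPattern, partner, blockSign, h1, h2, hne1]
    · simp [blockPattern, partner, blockSign, h1, hne2, pairBlock_comm w (a - 1) a]
  · by_cases h1 : Odd a.val
    · simp [blockPattern, partner, blockSign, h1, hne1]
    · by_cases h2 : a.val = 0 ∧ Odd d
      · simp [blockPattern, partner, h2]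
      · simp only [blockPattern, partner, blockSign, h1, h2, hne2, if_false,
          pairBlock_comm w (a - 1) a]

/-- The unnormalised eigenvector `|a⟩ ± |p⟩` of the outcome `a`, where `p` is the partner of `a`. -/
def blockVector [NeZero d] (x : Fin 3) (a : Fin d) : Fin d → ℂ :=
  Pi.single a 1 + Pi.single (partner x a) (blockSign x a : ℂ)

/-- The squared norm of `blockVector x a`. -/
def blockNormSq [NeZero d] (x : Fin 3) (a : Fin d) : ℂ := 1 + (blockSign x a : ℂ) ^ 2

theorem blockNormSq_eq [NeZero d] (x : Fin 3) (a : Fin d) :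
    blockNormSq x a = if partner x a = a then 1 else 2 := by
  unfold blockNormSq
  rw [← Complex.ofReal_pow, blockSign_sq]
  split_ifs <;> norm_num

theorem blockNormSq_ne_zero [NeZero d] (x : Fin 3) (a : Fin d) : blockNormSq x a ≠ 0 := by
  rw [blockNormSq_eq]; split_ifs <;> norm_num

/-- Distinct outcomes either have disjoint supports or share a block with opposite signs. The
bilinear product suffices since all entries are real. -/
theorem blockVector_dotProduct [NeZero d] (hd : 2 ≤ d) (x : Fin 3) (a a' : Fin d) :
    blockVector x a ⬝ᵥ blockVector x a' = if a = a' then blockNormSq x a else 0 := by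
  have hinj : ∀ {b b'}, partner x b = b' ↔ b = partner x b' := fun {b b'} =>
    ⟨fun h => by rw [← h, partner_partner hd], fun h => by rw [h, partner_partner hd]⟩
  have happ : ∀ j, blockVector x a' j =
      (if j = a' then 1 else 0) + if j = partner x a' then (blockSign x a' : ℂ) else 0 := fun j => by
    simp [blockVector, Pi.single_apply]
  have hdot : blockVector x a ⬝ᵥ blockVector x a' =
      blockVector x a' a + blockSign x a * blockVector x a' (partner x a) := by
    conv_lhs => rw [blockVector, add_dotProduct, single_dotProduct, single_dotProduct, one_mul]
  rw [hdot, happ, happ, blockNormSq]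
  by_cases h1 : a = a'
  · subst h1
    by_cases h2 : partner x a = a
    · have : blockSign x a = 0 := by simp [blockSign, h2]
      simp [this]
    · simp [h2, Ne.symm h2, sq]
  · have h5 : partner x a ≠ partner x a' := fun h => h1 (by
      rw [← partner_partner hd x a, h, partner_partner hd])
    by_cases h2 : a = partner x a'
    · have h3 : blockSign x a = -blockSign x a' := by rw [h2, blockSign_partner hd]
      have h4 : partner x a = a' := hinj.2 h2
      rw [if_neg h1, if_pos h2, if_pos h4, if_neg h5, if_neg h1, h3]
      push_cast; ring
    · have h4 : partner x a ≠ a' := fun h => h2 (hinj.1 h)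
      rw [if_neg h1, if_neg h2, if_neg h4, if_neg h5, if_neg h1]
      ring

theorem blockPattern_one_eq_vecMulVec [NeZero d] (hd : 2 ≤ d) (x : Fin 3) (a : Fin d) :
    blockPattern (fun _ => 1) x a =
      Matrix.vecMulVec ((blockNormSq x a)⁻¹ • blockVector x a) (blockVector x a) := by
  rw [blockPattern_eq hd]
  ext i j
  rw [Matrix.vecMulVec_apply, blockNormSq_eq]
  by_cases h : partner x a = a
  · have h' : blockSign x a = 0 := by simp [blockSign, h]
    rw [if_pos h, if_pos h]
    simp only [singleBlock, Matrix.single_apply, blockVector, h', Pi.add_apply, Pi.smul_apply,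
      Pi.single_apply, eq_comm (a := a)]
    by_cases hi : i = a <;> by_cases hj : j = a <;> simp [hi, hj]
  · have h2 : (blockSign x a : ℂ) ^ 2 = 1 := by
      rw [← Complex.ofReal_pow, blockSign_sq, if_neg h, Complex.ofReal_one]
    rw [if_neg h, if_neg h]
    rw [blockVector]
    generalize partner x a = p at h ⊢
    generalize blockSign x a = s at h2 ⊢
    simp only [pairBlock, Matrix.add_apply, Matrix.single_apply, Pi.add_apply,
      Pi.smul_apply, Pi.single_apply, smul_eq_mul, eq_comm (b := i), eq_comm (b := j)]
    by_cases hi : i = a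
    · have hi' : i ≠ p := fun h' => h (h'.symm.trans hi)
      by_cases hj : j = a
      · have hj' : j ≠ p := fun h' => h (h'.symm.trans hj)
        simp [hi, hj, Ne.symm h]
      · by_cases hj' : j = p <;> simp [hi, hj, hj', h, Ne.symm h]
        ring
    · by_cases hi' : i = p
      · by_cases hj : j = a
        · simp [hi', hj, h, Ne.symm h]
          ring
        · by_cases hj' : j = p <;> simp [hi', hj, hj', h]
          -- The `(p, p)` entry of the rank-one matrix is `s ^ 2 / 2`.
          linear_combination (-1 / 2 : ℂ) * h2
      · simp [hi, hi']

theorem blockPattern_one_mul [NeZero d] (hd : 2 ≤ d) (x : Fin 3) (a a' : Fin d) :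
    blockPattern (fun _ => 1) x a * blockPattern (fun _ => 1) x a' =
      if a = a' then blockPattern (fun _ => 1) x a else 0 := by
  rw [blockPattern_one_eq_vecMulVec hd, blockPattern_one_eq_vecMulVec hd,
    Matrix.vecMulVec_mul_vecMulVec, dotProduct_smul, blockVector_dotProduct hd]
  split_ifs with h
  · subst h
    simp [blockNormSq_ne_zero]
  · simp

/-- Orthogonality of the `d` block vectors says `U * Rᵀ = 1`; for square matrices this gives `Rᵀ * U
= 1`, which is completeness. -/
theorem sum_blockPattern_one [NeZero d] (hd : 2 ≤ d) (x : Fin 3) :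
    ∑ a : Fin d, blockPattern (fun _ => 1) x a = 1 := by
  let U : Matrix (Fin d) (Fin d) ℂ := Matrix.of fun a => blockVector x a
  let R : Matrix (Fin d) (Fin d) ℂ := Matrix.of fun a => (blockNormSq x a)⁻¹ • blockVector x a
  have h : U * R.transpose = 1 := by
    ext a a'
    have : (U * R.transpose) a a' =
      blockVector x a ⬝ᵥ ((blockNormSq x a')⁻¹ • blockVector x a') := rfl
    rw [this, dotProduct_smul, blockVector_dotProduct hd, Matrix.one_apply]
    split_ifs with h
    · subst h; simp [blockNormSq_ne_zero]
    · simp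
  rw [← mul_eq_one_comm.1 h]
  ext i j
  rw [Matrix.sum_apply, Matrix.mul_apply]
  refine Finset.sum_congr rfl fun a _ => ?_
  rw [blockPattern_one_eq_vecMulVec hd, Matrix.vecMulVec_apply]
  rfl

theorem blockPattern_transpose [NeZero d] (w : Fin d → ℝ) (x : Fin 3) (a : Fin d) :
    (blockPattern w x a).transpose = blockPattern w x a := by
  have h1 : ∀ a, (singleBlock w a).transpose = singleBlock w a := fun a => by simp [singleBlock]
  have h2 : ∀ p q s, (pairBlock w p q s).transpose = pairBlock w p q s := fun p q s => by
    simp only [pairBlock, Matrix.transpose_add, Matrix.transpose_single]; abel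
  fin_cases x <;> simp only [blockPattern] <;> (try split_ifs) <;> simp only [h1, h2]

theorem blockPattern_conjTranspose [NeZero d] (w : Fin d → ℝ) (x : Fin 3) (a : Fin d) :
    (blockPattern w x a).conjTranspose = blockPattern w x a := by
  have h1 : ∀ a, (singleBlock w a).conjTranspose = singleBlock w a := fun a => by
    simp [singleBlock, Matrix.conjTranspose_single]
  have h2 : ∀ p q s, (pairBlock w p q s).conjTranspose = pairBlock w p q s := fun p q s => by
    simp only [pairBlock, Matrix.conjTranspose_add, Matrix.conjTranspose_single, RCLike.star_def,
      Complex.conj_ofReal]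
    abel
  fin_cases x <;> simp only [blockPattern] <;> (try split_ifs) <;> simp only [h1, h2]

theorem isProjectiveMeasurement_idealMeasurement [NeZero d] (hd : 2 ≤ d) (x : Fin 3) :
    IsProjectiveMeasurement (idealMeasurement d x) := by
  have hmul : ∀ a a', idealMeasurement d x a * idealMeasurement d x a' =
      if a = a' then idealMeasurement d x a else 0 := fun a a' => by
    simp only [idealMeasurement]
    rw [← map_mul, blockPattern_one_mul hd]
    split_ifs <;> simp
  refine ⟨⟨fun a => ?_, ?_⟩, hmul⟩
  · refine ContinuousLinearMap.IsPositive.of_isStarProjection ⟨?_, ?_⟩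
    · rw [IsIdempotentElem, hmul, if_pos rfl]
    · rw [IsSelfAdjoint, idealMeasurement, ← map_star, Matrix.star_eq_conjTranspose,
        blockPattern_conjTranspose]
  · simp only [idealMeasurement]
    rw [← map_sum, sum_blockPattern_one hd, map_one]

end Blocks

/-! ### Slices of vectors along Bob's basis -/

section Slices

universe u

variable {E : Type u} [NormedAddCommGroup E] [InnerProductSpace ℂ E] {d : ℕ}

/-- The contraction `1 ⊗ ⟨i|` of a vector of `E ⊗ ℂ^d`. -/
def slice (i : Fin d) : E ⊗[ℂ] Qudit d →L[ℂ] E :=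
  (TensorProduct.ridIsometry ℂ E).toContinuousLinearEquiv.toContinuousLinearMap ∘L
    (innerSL ℂ (ket i)).lTensor E

theorem slice_tmul (i : Fin d) (h : E) (y : Qudit d) : slice i (h ⊗ₜ[ℂ] y) = y i • h := by
  simp [slice, ket, EuclideanSpace.inner_single_left]

theorem inner_tmul_ket (h : E) (i : Fin d) (z : E ⊗[ℂ] Qudit d) :
    ⟪h ⊗ₜ[ℂ] ket i, z⟫_ℂ = ⟪h, slice i z⟫_ℂ := by
  induction z using TensorProduct.induction_on with
  | zero => simp
  | tmul x y =>
    simp [slice_tmul, ket, EuclideanSpace.inner_single_left, mul_comm]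
  | add x y hx hy => simp only [map_add, inner_add_right, hx, hy]

theorem sum_slice_tmul_ket (z : E ⊗[ℂ] Qudit d) : ∑ i, slice i z ⊗ₜ[ℂ] ket i = z := by
  induction z using TensorProduct.induction_on with
  | zero => simp
  | tmul x y =>
    have hy : ∑ i, y i • (ket i : Qudit d) = y := by
      ext j; simp [ket, Pi.single_apply]
    simp only [slice_tmul, TensorProduct.smul_tmul]
    rw [← TensorProduct.tmul_sum, hy]
  | add x y hx hy =>
    simp only [map_add, TensorProduct.add_tmul, Finset.sum_add_distrib, hx, hy]

theorem slice_rTensor (i : Fin d) (M : E →L[ℂ] E) (z : E ⊗[ℂ] Qudit d) :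
    slice i (M.rTensor (Qudit d) z) = M (slice i z) := by
  induction z using TensorProduct.induction_on with
  | zero => simp
  | tmul x y => rw [ContinuousLinearMap.rTensor_tmul, slice_tmul, slice_tmul, map_smul]
  | add x y hx hy => simp only [map_add, hx, hy]

theorem adjoint_slice_apply [CompleteSpace E] (i : Fin d) (h : E) :
    ContinuousLinearMap.adjoint (slice i) h = h ⊗ₜ[ℂ] (ket i : Qudit d) :=
  ext_inner_right ℂ fun z => by
    rw [ContinuousLinearMap.adjoint_inner_left]
    exact (inner_tmul_ket h i z).symm

theorem onAlice_tmul_ket (Φ : E →ₗᵢ[ℂ] E ⊗[ℂ] Qudit d) {u v : E} {y : Qudit d}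
    (h : Φ u = v ⊗ₜ y) (i : Fin d) : onAlice Φ (u ⊗ₜ ket i) = v ⊗ₜ (y ⊗ₜ ket i) := by
  simp [onAlice, h]

end Slices

/-! ### The target state and its assemblage -/

section Target

variable {d : ℕ} (c : Fin d → ℝ)

theorem toEuclideanCLM_ket (A : Matrix (Fin d) (Fin d) ℂ) (i : Fin d) :
    Matrix.toEuclideanCLM (n := Fin d) (𝕜 := ℂ) A (ket i) = ∑ j, A j i • ket j := by
  ext k
  rw [Matrix.ofLp_toEuclideanCLM]
  simp [ket, Pi.single_apply]

theorem slice_targetState (i : Fin d) : slice i (targetState c) = (c i : ℂ) • ket i := by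
  simp [targetState, slice_tmul, ket]

theorem norm_targetState (hc : ∑ i, c i ^ 2 = 1) : ‖targetState c‖ = 1 := by
  have h : ⟪targetState c, targetState c⟫_ℂ = 1 := by
    have ht : targetState c = ∑ i, ((c i : ℂ) • ket i) ⊗ₜ[ℂ] (ket i : Qudit d) := by
      simp only [targetState, TensorProduct.smul_tmul']
    rw [ht]
    simp only [sum_inner, inner_sum, TensorProduct.inner_tmul, inner_ket_ket, inner_smul_left,
      inner_smul_right]
    refine Eq.trans ?_ (by exact_mod_cast hc : ∑ i, (c i : ℂ) ^ 2 = 1)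
    simp [sq]
  have h2 : ‖targetState c‖ ^ 2 = 1 :=
    (inner_self_eq_norm_sq (𝕜 := ℂ) (targetState c)).symm.trans
      ((congrArg RCLike.re h).trans RCLike.one_re)
  exact (pow_eq_one_iff_of_nonneg (norm_nonneg _) two_ne_zero).1 h2

theorem hasTrace_pureState {E : Type*} [NormedAddCommGroup E] [InnerProductSpace ℂ E] (ψ : E) :
    HasTrace (pureState ψ) ((‖ψ‖ ^ 2 : ℝ) : ℂ) := fun ι b => by
  have h := b.hasSum_inner_mul_inner ψ ψ
  have h' : ⟪ψ, ψ⟫_ℂ = ((‖ψ‖ ^ 2 : ℝ) : ℂ) := by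
    rw [inner_self_eq_norm_sq_to_K, Complex.ofReal_pow]; rfl
  rw [h'] at h
  refine h.congr_fun fun k => ?_
  rw [pureState, InnerProductSpace.rankOne_apply, inner_smul_right]

theorem isDensityOperator_targetState (hc : ∑ i, c i ^ 2 = 1) :
    IsDensityOperator (pureState (targetState c)) := by
  refine ⟨InnerProductSpace.isPositive_rankOne_self _, ?_⟩
  have := hasTrace_pureState (targetState c)
  rwa [norm_targetState c hc, one_pow, Complex.ofReal_one] at this

/-- By Parseval the `(i, j)` entry of the partial trace is `c i * c j * ⟨j|M|i⟩`, a transposed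
entry; the blocks are symmetric. -/
theorem producesAssemblage_targetState [NeZero d] :
    ProducesAssemblage (pureState (targetState c)) (idealMeasurement d) (idealAssemblage c) := by
  intro x a ι b i j
  have h := b.hasSum_inner_mul_inner ((c j : ℂ) • ket j)
    (idealMeasurement d x a ((c i : ℂ) • ket i))
  have h2 : ⟪((c j : ℂ) • ket j : Qudit d), idealMeasurement d x a ((c i : ℂ) • ket i)⟫_ℂ =
      idealAssemblage c x a i j := by
    rw [idealAssemblage, blockPattern_apply, map_smul, idealMeasurement, toEuclideanCLM_ket]
    conv_rhs => rw [← blockPattern_transpose]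
    simp only [inner_smul_left, inner_smul_right, inner_sum, inner_ket_ket, Complex.conj_ofReal,
      Matrix.transpose_apply, mul_ite, mul_one, mul_zero, Finset.sum_ite_eq, Finset.mem_univ,
      if_true]
    ring
  rw [h2] at h
  refine h.congr_fun fun k => ?_
  have h3 : ⟪targetState c, b k ⊗ₜ[ℂ] (ket j : Qudit d)⟫_ℂ = ⟪((c j : ℂ) • ket j), b k⟫_ℂ := by
    have := congrArg (starRingEnd ℂ) (inner_tmul_ket (b k) j (targetState c))
    rw [slice_targetState, inner_conj_symm] at this
    rw [← this]
    exact (inner_conj_symm (𝕜 := ℂ) (targetState c) (b k ⊗ₜ[ℂ] (ket j : Qudit d))).symm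
  rw [inner_tmul_ket, mul_apply_eq_comp, slice_rTensor, pureState,
    InnerProductSpace.rankOne_apply, map_smul, slice_targetState, map_smul, inner_smul_right]
  exact congrArg (· * _) h3

end Target

/-! ### Transporting `V 0` to all `V i` -/

section Certification

open ContinuousLinearMap

universe u

variable {H : Type u} [NormedAddCommGroup H] [InnerProductSpace ℂ H] [CompleteSpace H]
  {K : Type*} [NormedAddCommGroup K] [InnerProductSpace ℂ K] {d : ℕ}

/-- If `M 1` and `M 2` act on the family `V` by the ideal projections, neighbouring members of
the family, and hence all of them, are carried into each other by operators on `H`. -/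
theorem exists_comp_eq [NeZero d] {M : Fin 3 → Fin d → H →L[ℂ] H}
    (hM : ∀ x, IsMeasurement (M x)) {V : Fin d → K →L[ℂ] H}
    (hMV : ∀ x a i, M x a ∘L V i = ∑ j, blockPattern (fun _ => 1) x a j i • V j) (i : Fin d) :
    ∃ W : H →L[ℂ] H, W ∘L V 0 = V i ∧ adjoint W ∘L V i = V 0 := by
  have hpair : ∀ x (p q : Fin d), p ≠ q →
      blockPattern (fun _ => (1 : ℝ)) x p = pairBlock (fun _ => 1) p q 1 →
      ∃ T : H →L[ℂ] H, adjoint T = T ∧ T ∘L V p = V q ∧ T ∘L V q = V p := by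
    intro x p q hpq hP
    have h1 : ∀ i, M x p ∘L V i = ∑ j, pairBlock (fun _ => 1) p q 1 j i • V j := fun i => by
      rw [hMV, hP]
    -- On the pair, `M x p` sends both `V p` and `V q` to their average, so this reflection swaps
    -- them.
    refine ⟨(2 : ℂ) • M x p - 1, ?_, ?_, ?_⟩
    · have h2 : adjoint (M x p) = M x p := ((hM x).1 p).isSelfAdjoint
      have h3 : adjoint (1 : H →L[ℂ] H) = 1 := star_one _
      rw [map_sub, LinearIsometryEquiv.map_smulₛₗ, h2, h3]
      rw [Complex.conj_ofNat]
    all_goals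
      rw [sub_comp, smul_comp, h1]
      simp [pairBlock, Matrix.single_apply, add_smul, Finset.sum_add_distrib, hpq, Ne.symm hpq]
      ext v
      simp
  suffices ∀ n (hn : n < d), ∃ W : H →L[ℂ] H, W ∘L V 0 = V ⟨n, hn⟩ ∧
    adjoint W ∘L V ⟨n, hn⟩ = V 0 from this i i.isLt
  intro n
  induction n with
  | zero =>
    intro hn
    refine ⟨1, rfl, ?_⟩
    have h3 : adjoint (1 : H →L[ℂ] H) = 1 := star_one _
    rw [h3]; rfl
  | succ n ih =>
    intro hn
    obtain ⟨W, hW, hW'⟩ := ih (by omega)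
    have hne : (⟨n, by omega⟩ : Fin d) ≠ ⟨n + 1, hn⟩ := fun h => by
      have := congrArg Fin.val h
      simp at this
    have hadd : (⟨n, by omega⟩ : Fin d) + 1 = ⟨n + 1, hn⟩ := Fin.ext (by
      rw [val_add_one_eq (by omega), if_neg]
      simp only; omega)
    obtain ⟨T, hT, h1, h2⟩ : ∃ T : H →L[ℂ] H, adjoint T = T ∧
        T ∘L V ⟨n, by omega⟩ = V ⟨n + 1, hn⟩ ∧ T ∘L V ⟨n + 1, hn⟩ = V ⟨n, by omega⟩ := by
      -- The edge from `n` to `n + 1` belongs to setting 1 for even `n` and to setting 2 for odd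
      -- `n`; the wrap-around block is never used.
      rcases Nat.even_or_odd n with h | h
      · refine hpair 1 _ _ hne ?_
        simp [blockPattern, h, hadd, hn.ne]
      · refine hpair 2 _ _ hne ?_
        simp [blockPattern, h, hadd]
    refine ⟨T ∘L W, by rw [comp_assoc, hW, h1], ?_⟩
    rw [adjoint_comp, hT, comp_assoc, h2, hW']

variable [CompleteSpace K]

/-- Turns the vector identities `z ↦ A z ⊗ s` into the product form `A A† ⊗ |s⟩⟨t|` required for
mixed states. -/
theorem comp_adjoint_flip_mkL {F : Type*} [NormedAddCommGroup F] [InnerProductSpace ℂ F]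
    [FiniteDimensional ℂ F] (A : K →L[ℂ] H) (s t : F) :
    ((TensorProduct.mkL ℂ H F).flip s ∘L A) ∘L adjoint ((TensorProduct.mkL ℂ H F).flip t ∘L A) =
      TensorProduct.mapL (A ∘L adjoint A) (InnerProductSpace.rankOne ℂ s t) := by
  have hadj : ∀ h y, adjoint ((TensorProduct.mkL ℂ H F).flip t) (h ⊗ₜ[ℂ] y) = ⟪t, y⟫_ℂ • h :=
    fun h y => ext_inner_left ℂ fun v => by
      rw [adjoint_inner_right, inner_smul_right]
      exact (TensorProduct.inner_tmul ..).trans (mul_comm _ _)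
  rw [adjoint_comp]
  refine ContinuousLinearMap.coe_injective (TensorProduct.ext' fun h y => ?_)
  simp [hadj]

end Certification

/-! ### Certification of the state and the measurements -/

section Certification

open ContinuousLinearMap

universe u

variable {H : Type u} [NormedAddCommGroup H] [InnerProductSpace ℂ H] {d : ℕ}

theorem onAlice_sum (Φ : H →ₗᵢ[ℂ] H ⊗[ℂ] Qudit d) (f : Fin d → H ⊗[ℂ] Qudit d) :
    onAlice Φ (∑ i, f i) = ∑ i, onAlice Φ (f i) :=
  map_sum (onAlice Φ).toLinearMap f Finset.univ

theorem onAlice_smul (Φ : H →ₗᵢ[ℂ] H ⊗[ℂ] Qudit d) (s : ℂ) (z : H ⊗[ℂ] Qudit d) :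
    onAlice Φ (s • z) = s • onAlice Φ z :=
  map_smul (onAlice Φ).toLinearMap s z

theorem onAlice_eq_tmul_targetState (c : Fin d → ℝ) (Φ : H →ₗᵢ[ℂ] H ⊗[ℂ] Qudit d)
    {z : H ⊗[ℂ] Qudit d} {v : Fin d → H} {v₀ : H} (hz : ∀ i, slice i z = (c i : ℂ) • v i)
    (hv : ∀ i, Φ (v i) = v₀ ⊗ₜ ket i) : onAlice Φ z = v₀ ⊗ₜ[ℂ] targetState c := by
  conv_lhs => rw [← sum_slice_tmul_ket z]
  rw [onAlice_sum, targetState, TensorProduct.tmul_sum]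
  refine Finset.sum_congr rfl fun i _ => ?_
  rw [hz, ← TensorProduct.smul_tmul', onAlice_smul, onAlice_tmul_ket Φ (hv i),
    TensorProduct.tmul_smul]

theorem onAlice_rTensor_eq_tmul (c : Fin d → ℝ) (Φ : H →ₗᵢ[ℂ] H ⊗[ℂ] Qudit d)
    {z : H ⊗[ℂ] Qudit d} {v : Fin d → H} {v₀ : H} (hz : ∀ i, slice i z = (c i : ℂ) • v i)
    (hv : ∀ i, Φ (v i) = v₀ ⊗ₜ ket i) {M : H →L[ℂ] H} {A : Matrix (Fin d) (Fin d) ℂ}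
    (hM : ∀ i, M (v i) = ∑ j, A j i • v j) :
    onAlice Φ (M.rTensor (Qudit d) z) = v₀ ⊗ₜ[ℂ]
      (Matrix.toEuclideanCLM (n := Fin d) (𝕜 := ℂ) A).rTensor (Qudit d) (targetState c) := by
  conv_lhs => rw [← sum_slice_tmul_ket z]
  rw [targetState, map_sum, onAlice_sum, map_sum, TensorProduct.tmul_sum]
  refine Finset.sum_congr rfl fun i _ => ?_
  have hΦ : Φ (M (v i)) =
      v₀ ⊗ₜ[ℂ] Matrix.toEuclideanCLM (n := Fin d) (𝕜 := ℂ) A (ket i) := by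
    rw [hM, toEuclideanCLM_ket, map_sum, TensorProduct.tmul_sum]
    exact Finset.sum_congr rfl fun j _ => by rw [map_smul, hv, TensorProduct.tmul_smul]
  rw [hz, ← TensorProduct.smul_tmul', map_smul, onAlice_smul, rTensor_tmul,
    onAlice_tmul_ket Φ hΦ, map_smul, rTensor_tmul, TensorProduct.tmul_smul]

theorem conj_mul_self_eq {K L : Type*} [NormedAddCommGroup K] [InnerProductSpace ℂ K]
    [CompleteSpace K] [NormedAddCommGroup L] [InnerProductSpace ℂ L] [CompleteSpace L]
    (T : K →L[ℂ] L) (N : K →L[ℂ] K) {R : K →L[ℂ] K} (hR : adjoint R = R) :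
    T ∘L (N * (R * R)) ∘L adjoint T = (T ∘L N ∘L R) ∘L adjoint (T ∘L R) := by
  rw [adjoint_comp, hR]
  rfl

variable [CompleteSpace H]

theorem hasSum_of_producesAssemblage [NeZero d] {c : Fin d → ℝ} (hc : ∀ i, 0 < c i)
    {R : H ⊗[ℂ] Qudit d →L[ℂ] H ⊗[ℂ] Qudit d} (hR : adjoint R = R)
    {M : Fin 3 → Fin d → H →L[ℂ] H} (hM : ProducesAssemblage (R * R) M (idealAssemblage c))
    {V : Fin d → H ⊗[ℂ] Qudit d →L[ℂ] H} (hV : ∀ i, V i = (c i : ℂ)⁻¹ • (slice i ∘L R))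
    {ι : Type u} (b : HilbertBasis ι ℂ H) (x : Fin 3) (a i j : Fin d) :
    HasSum (fun k => ⟪b k, M x a (V i (adjoint (V j) (b k)))⟫_ℂ)
      (blockPattern (fun _ => 1) x a i j) := by
  have h := ((hM x a ι b i j).mul_left ((c i : ℂ)⁻¹ * (c j : ℂ)⁻¹))
  have hi : (c i : ℂ) ≠ 0 := by exact_mod_cast (hc i).ne'
  have hj : (c j : ℂ) ≠ 0 := by exact_mod_cast (hc j).ne'
  have h2 : (c i : ℂ)⁻¹ * (c j : ℂ)⁻¹ * idealAssemblage c x a i j =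
      blockPattern (fun _ => 1) x a i j := by
    rw [idealAssemblage, blockPattern_apply]
    field_simp
  rw [h2] at h
  refine h.congr_fun fun k => ?_
  have hadj : adjoint (V j) (b k) = (c j : ℂ)⁻¹ • R (b k ⊗ₜ[ℂ] ket j) := by
    rw [hV, LinearIsometryEquiv.map_smulₛₗ, adjoint_comp, hR, smul_apply, comp_apply,
      adjoint_slice_apply, map_inv₀, Complex.conj_ofReal]
  rw [hadj, hV, inner_tmul_ket, mul_apply_eq_comp, mul_apply_eq_comp, slice_rTensor, smul_apply,
    comp_apply, map_smul, map_smul, map_smul, map_smul, inner_smul_right, inner_smul_right]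
  ring

/-- An assemblage that agrees with the ideal one certifies the target state and the ideal
measurements. -/
theorem exists_isometry_of_producesAssemblage [NeZero d] (hd : 2 ≤ d) {c : Fin d → ℝ}
    (hc : ∀ i, 0 < c i) (hc_sum : ∑ i, c i ^ 2 = 1)
    {ρ : H ⊗[ℂ] Qudit d →L[ℂ] H ⊗[ℂ] Qudit d} {M : Fin 3 → Fin d → H →L[ℂ] H}
    (hρ : IsDensityOperator ρ) (hM : ∀ x, IsMeasurement (M x))
    (hσ : ProducesAssemblage ρ M (idealAssemblage c)) :
    ∃ Φ : H →ₗᵢ[ℂ] H ⊗[ℂ] Qudit d,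
      (∀ ψ : H ⊗[ℂ] Qudit d, ρ = pureState ψ →
        ∃ junk : H, ‖junk‖ = 1 ∧
          onAlice Φ ψ = junk ⊗ₜ[ℂ] targetState c ∧
          ∀ x a, onAlice Φ ((M x a).rTensor (Qudit d) ψ) =
            junk ⊗ₜ[ℂ] (idealMeasurement d x a).rTensor (Qudit d) (targetState c)) ∧
      ∃ ρjunk : H →L[ℂ] H, IsDensityOperator ρjunk ∧
        (onAlice Φ).toContinuousLinearMap ∘L ρ ∘L
            ContinuousLinearMap.adjoint (onAlice Φ).toContinuousLinearMap =
          TensorProduct.mapL ρjunk (pureState (targetState c)) ∧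
        ∀ x a, (onAlice Φ).toContinuousLinearMap ∘L ((M x a).rTensor (Qudit d) * ρ) ∘L
            ContinuousLinearMap.adjoint (onAlice Φ).toContinuousLinearMap =
          TensorProduct.mapL ρjunk
            ((idealMeasurement d x a).rTensor (Qudit d) * pureState (targetState c)) := by
  obtain ⟨hρpos, hρtr⟩ := hρ
  obtain ⟨R, hR, rfl⟩ := exists_isSelfAdjoint_mul_self hρpos
  -- The whole joint space serves as a purifying index, so mixed and pure states are handled
  -- together.
  let V : Fin d → H ⊗[ℂ] Qudit d →L[ℂ] H := fun i => (c i : ℂ)⁻¹ • (slice i ∘L R)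
  have hslice : ∀ z i, slice i (R z) = (c i : ℂ) • V i z := fun z i => by
    have hi : (c i : ℂ) ≠ 0 := by exact_mod_cast (hc i).ne'
    simp [V, smul_smul, hi]
  have hVsum : ∀ {ι : Type u} (b : HilbertBasis ι ℂ H) x a i j,
      HasSum (fun k => ⟪b k, M x a (V i (adjoint (V j) (b k)))⟫_ℂ)
        (blockPattern (fun _ => 1) x a i j) := fun b =>
    hasSum_of_producesAssemblage hc hR hσ (fun _ => rfl) b
  have hMV : ∀ x a i, M x a ∘L V i = ∑ j, blockPattern (fun _ => 1) x a j i • V j := by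
    obtain ⟨w, b, -⟩ := exists_hilbertBasis ℂ H
    exact fun x => comp_eq_sum_of_hasSum b (hM x) (blockPattern_transpose _ x)
      (sum_blockPattern_one hd x) (blockPattern_one_mul hd x) (hVsum b x)
  have horth : ∀ i j, i ≠ j → adjoint (V i) ∘L V j = 0 := by
    intro i j hij
    have h1 : M 0 i ∘L V i = V i := by
      rw [hMV]; simp [blockPattern, singleBlock, Matrix.single_apply]
    have h2 : M 0 i ∘L V j = 0 := by
      rw [hMV]; simp [blockPattern, singleBlock, hij]
    have h3 : adjoint (M 0 i) = M 0 i := ((hM 0).1 i).isSelfAdjoint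
    rw [← h1, adjoint_comp, h3, comp_assoc, h2, comp_zero]
  choose W hW hW' using exists_comp_eq hM hMV
  obtain ⟨Φ, hΦ⟩ := exists_isometry_comp_eq_tmul_ket V W hW hW' horth
  have hstate : ∀ z, onAlice Φ (R z) = V 0 z ⊗ₜ[ℂ] targetState c := fun z =>
    onAlice_eq_tmul_targetState c Φ (hslice z) fun i => hΦ i z
  have hmeas : ∀ x a z, onAlice Φ ((M x a).rTensor (Qudit d) (R z)) = V 0 z ⊗ₜ[ℂ]
      (idealMeasurement d x a).rTensor (Qudit d) (targetState c) := fun x a z =>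
    onAlice_rTensor_eq_tmul c Φ (hslice z) (fun i => hΦ i z) fun i => by
      have := congrArg (· z) (hMV x a i)
      simpa [_root_.sum_apply] using this
  have hstate' : (onAlice Φ).toContinuousLinearMap ∘L R =
      (TensorProduct.mkL ℂ H (Qudit d ⊗[ℂ] Qudit d)).flip (targetState c) ∘L V 0 :=
    ContinuousLinearMap.ext hstate
  refine ⟨Φ, fun ψ hψ => ?_, V 0 ∘L adjoint (V 0), ⟨isPositive_self_comp_adjoint _, ?_⟩, ?_, ?_⟩
  · have hnorm : ‖ψ‖ = 1 := by
      obtain ⟨w, b, -⟩ := exists_hilbertBasis ℂ (H ⊗[ℂ] Qudit d)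
      have h1 := (hasTrace_pureState ψ w b).unique (hψ ▸ hρtr w b)
      have h2 : ‖ψ‖ ^ 2 = 1 := by exact_mod_cast h1
      exact (pow_eq_one_iff_of_nonneg (norm_nonneg _) two_ne_zero).1 h2
    have hψR : R (R ψ) = ψ := by
      have h1 : R (R ψ) = pureState ψ ψ := congrArg (· ψ) hψ
      rw [h1, pureState, InnerProductSpace.rankOne_apply, inner_self_eq_norm_sq_to_K, hnorm]
      simp
    have h1 := hstate (R ψ)
    rw [hψR] at h1
    -- Since `R (R ψ) = ψ`, evaluating the operator identities at `R ψ` yields the pure case.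
    refine ⟨V 0 (R ψ), ?_, h1, fun x a => ?_⟩
    · have h2 := congrArg norm h1
      rw [LinearIsometry.norm_map, hnorm, TensorProduct.norm_tmul, norm_targetState c hc_sum,
        mul_one] at h2
      exact h2.symm
    · have h2 := hmeas x a (R ψ)
      rwa [hψR] at h2
  · intro ι b
    -- The trace of `V 0 V 0†` is the `(0, 0)` entry of `∑ a, P a = 1`; any setting would do.
    have h := hasSum_sum (s := Finset.univ) fun a _ => hVsum b 0 a 0 0
    rw [← Matrix.sum_apply, sum_blockPattern_one hd, Matrix.one_apply_eq] at h
    refine h.congr_fun fun k => ?_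
    rw [← inner_sum, ← _root_.sum_apply, (hM 0).2]
    rfl
  · refine (conj_mul_self_eq (L := H ⊗[ℂ] (Qudit d ⊗[ℂ] Qudit d))
      (onAlice Φ).toContinuousLinearMap 1 hR).trans ?_
    rw [pureState, ← comp_adjoint_flip_mkL, ← hstate']
    rfl
  · intro x a
    have hmeas' : (onAlice Φ).toContinuousLinearMap ∘L (M x a).rTensor (Qudit d) ∘L R =
        (TensorProduct.mkL ℂ H (Qudit d ⊗[ℂ] Qudit d)).flip
          ((idealMeasurement d x a).rTensor (Qudit d) (targetState c)) ∘L V 0 :=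
      ContinuousLinearMap.ext (hmeas x a)
    refine (conj_mul_self_eq (L := H ⊗[ℂ] (Qudit d ⊗[ℂ] Qudit d))
      (onAlice Φ).toContinuousLinearMap _ hR).trans ?_
    rw [pureState, mul_def, InnerProductSpace.comp_rankOne, ← comp_adjoint_flip_mkL, ← hstate',
      ← hmeas']

end Certification

end Steering

end

open Steering in
theorem mainTheorem1 (d : ℕ) [NeZero d] (c : Fin d → ℝ)
    (hc_pos : ∀ i, 0 < c i) (hc_lt : ∀ i, c i < 1) (hc_sum : ∑ i, c i ^ 2 = 1) :
    -- the ideal assemblage is the one of the target state under the ideal measurements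
    (IsDensityOperator (pureState (targetState c)) ∧
      (∀ x, IsProjectiveMeasurement (idealMeasurement d x)) ∧
      ProducesAssemblage (pureState (targetState c)) (idealMeasurement d) (idealAssemblage c)) ∧
    -- it certifies the target state and the ideal measurements
    ∀ (H : Type*) [NormedAddCommGroup H] [InnerProductSpace ℂ H] [CompleteSpace H]
      (ρ : H ⊗[ℂ] Qudit d →L[ℂ] H ⊗[ℂ] Qudit d) (M : Fin 3 → Fin d → H →L[ℂ] H),
      IsDensityOperator ρ → (∀ x, IsMeasurement (M x)) →
      ProducesAssemblage ρ M (idealAssemblage c) →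
      ∃ Φ : H →ₗᵢ[ℂ] H ⊗[ℂ] Qudit d,
        -- a pure joint state
        (∀ ψ : H ⊗[ℂ] Qudit d, ρ = pureState ψ →
          ∃ junk : H, ‖junk‖ = 1 ∧
            onAlice Φ ψ = junk ⊗ₜ[ℂ] targetState c ∧
            ∀ x a, onAlice Φ ((M x a).rTensor (Qudit d) ψ) =
              junk ⊗ₜ[ℂ] (idealMeasurement d x a).rTensor (Qudit d) (targetState c)) ∧
        -- an arbitrary joint state
        ∃ ρjunk : H →L[ℂ] H, IsDensityOperator ρjunk ∧
          (onAlice Φ).toContinuousLinearMap ∘L ρ ∘L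
              ContinuousLinearMap.adjoint (onAlice Φ).toContinuousLinearMap =
            TensorProduct.mapL ρjunk (pureState (targetState c)) ∧
          ∀ x a, (onAlice Φ).toContinuousLinearMap ∘L ((M x a).rTensor (Qudit d) * ρ) ∘L
              ContinuousLinearMap.adjoint (onAlice Φ).toContinuousLinearMap =
            TensorProduct.mapL ρjunk
              ((idealMeasurement d x a).rTensor (Qudit d) * pureState (targetState c)) := by
  -- For `d = 1` normalisation would force `c 0 ^ 2 = 1`, against `0 < c 0 < 1`.
  have hd : 2 ≤ d := by
    by_contra h
    obtain rfl : d = 1 := by have := NeZero.ne d; omega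
    have h1 := hc_lt 0
    have h2 := hc_pos 0
    simp only [Fin.sum_univ_one] at hc_sum
    nlinarith
  exact ⟨⟨isDensityOperator_targetState c hc_sum, isProjectiveMeasurement_idealMeasurement hd,
    producesAssemblage_targetState c⟩, fun H _ _ _ ρ M hρ hM hσ =>
    exists_isometry_of_producesAssemblage hd hc_pos hc_sum hρ hM hσ⟩
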